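/- Notation. For a set $S$ in a Euclidean space let $m_S(x)=\{y\in S:\ \|x-y\|=\mathrm{dist}(x,S)\}$ be the set of points of $S$ closest to $x$, and let $E_S=\{x:\ \#m_S(x)>1\}$ be the medial axis of $S$. For $k\ge 2$ let $\Delta^{k-1}=\{t\in\mathbb{R}^k:\ t_i>0 \text{ for all } i,\ \sum_i t_i=1\}$ be the open $(k-1)$-dimensional simplex, $c=(1/k,\dots,1/k)$ its centre, $\partial\Delta^{k-1}=\{t\in\mathbb{R}^k:\ t_i\ge 0 \text{ for all } i,\ \sum_i t_i=1,\ t_i=0\text{ for some } i\}$ its boundary, and $E^{(k)}=E_{\partial\Delta^{k-1}}\cap\Delta^{k-1}$. Theorem 2.4 (the case $n=3$ of Yomdin's structure theorem). Let $M\subset\mathbb{R}^3$ be closed and nonempty, let $x_0\in\mathbb{R}^3$ and $2\le k\le 4$, and suppose that $m_M(x_0)$ consists of exactly $k$ points $y_1,\dots,y_k$. If $k=4$, suppose moreover that $y_1,\dots,y_4$ do not lie on a common circle (of the supporting sphere $\mathbb{S}(x_0,\mathrm{dist}(x_0,M))$). Let $V_1,\dots,V_k$ be pairwise disjoint sets and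 let $W_j$ be a neighbourhood of $y_j$ with $\overline{W_j}\subset V_j$, $j=1,\dots,k$. Put $\delta(x)=\mathrm{dist}(x,M)^2$ and $\delta_j(x)=\mathrm{dist}(x,M\cap\overline{W_j})^2$. Then there is a neighbourhood $U_0$ of $x_0$ on which $\delta=\min_j\delta_j$, and for every such $U_0$ the following holds. Let $$E(x_0)=\{x\in U_0:\ \exists\, i\ne j,\ \delta_i(x)=\delta_j(x)=\delta(x)\}.$$ Then there are an open neighbourhood $U\subset U_0$ of $x_0$ and a bilipschitz homeomorphism $\phi$ of $U$ onto $\Delta^{k-1}\times(0,1)^{4-k}$ such that $\phi(x_0)=(c,(\tfrac12,\dots,\tfrac12))$ and $$\phi(E(x_0)\cap U)=E^{(k)}\times(0,1)^{4-k}.$$ -/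

import Mathlib

open Set Topology
open scoped NNReal

namespace MedialAxis

noncomputable section

/-- The set `m(x)` of closest points of `M` to `x`. -/
def closestPoints {X : Type*} [PseudoMetricSpace X] (M : Set X) (x : X) : Set X :=
  {y ∈ M | dist x y = Metric.infDist x M}

/-- The medial axis `E_M`: the points having more than one closest point in `M`. -/
def medialAxis {X : Type*} [PseudoMetricSpace X] (M : Set X) : Set X :=
  {x | (closestPoints M x).Nontrivial}

/-- The squared distance function `x ↦ dist(x, S)²` of a (nonempty) set `S`. -/
def sqDist {X : Type*} [PseudoMetricSpace X] (S : Set X) (x : X) : ℝ :=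
  Metric.infDist x S ^ 2

/-- The conflict set `E(x₀)` in `U₀`: with `δ = dist(·, M)²` and `δ_j = dist(·, N_j)²`, the points
`x ∈ U₀` such that `δ_i x = δ_j x = δ x` for some `i ≠ j`. -/
def conflictSet {X ι : Type*} [PseudoMetricSpace X] (M : Set X) (N : ι → Set X) (U₀ : Set X) :
    Set X :=
  {x ∈ U₀ | ∃ i j, i ≠ j ∧ sqDist (N i) x = sqDist (N j) x ∧ sqDist (N j) x = sqDist M x}

/-- The open `(k-1)`-dimensional simplex `Δ^{k-1}`, in the hyperplane `∑ tᵢ = 1` of Euclidean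
`k`-space. -/
def openSimplex (k : ℕ) : Set (EuclideanSpace ℝ (Fin k)) :=
  {t | (∀ i, 0 < t i) ∧ ∑ i, t i = 1}

/-- The boundary `∂Δ^{k-1}` (relative to the hyperplane `∑ tᵢ = 1`): the union of the facets. -/
def simplexBoundary (k : ℕ) : Set (EuclideanSpace ℝ (Fin k)) :=
  {t | (∀ i, 0 ≤ t i) ∧ ∑ i, t i = 1 ∧ ∃ i, t i = 0}

/-- The centre `c` of the simplex. -/
def simplexCentre (k : ℕ) : EuclideanSpace ℝ (Fin k) :=
  WithLp.toLp 2 fun _ => (1 / (k : ℝ))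

/-- `E^{(k)} = E_{∂Δ^{k-1}} ∩ Δ^{k-1}`. -/
def simplexAxis (k : ℕ) : Set (EuclideanSpace ℝ (Fin k)) :=
  medialAxis (simplexBoundary k) ∩ openSimplex k

/-- The open cube `(0,1)^d` in Euclidean `d`-space (a single point for `d = 0`). -/
def openCube (d : ℕ) : Set (EuclideanSpace ℝ (Fin d)) :=
  {s | ∀ i, s i ∈ Ioo (0 : ℝ) 1}

/-- The centre of the cube `(0,1)^d`. -/
def cubeCentre (d : ℕ) : EuclideanSpace ℝ (Fin d) :=
  WithLp.toLp 2 fun _ => (1 / 2 : ℝ)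

/-- `φ` restricts to a bilipschitz homeomorphism of `U` onto `V`: it maps `U` onto `V`, and for some
`K` both `dist (φ x) (φ y) ≤ K * dist x y` and `dist x y ≤ K * dist (φ x) (φ y)` on `U`. -/
def IsBilipschitzOnto {X Y : Type*} [MetricSpace X] [MetricSpace Y] (φ : X → Y) (U : Set X)
    (V : Set Y) : Prop :=
  φ '' U = V ∧ ∃ K : ℝ≥0, LipschitzOnWith K φ U ∧
    ∀ x ∈ U, ∀ y ∈ U, dist x y ≤ K * dist (φ x) (φ y)

/-- `U₀` is a neighbourhood of `x₀` on which `dist(·, M)² = min_j dist(·, N_j)²`. -/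
def IsAdmissibleNhd {X ι : Type*} [PseudoMetricSpace X] (M : Set X) (N : ι → Set X) (x₀ : X)
    (U₀ : Set X) : Prop :=
  U₀ ∈ 𝓝 x₀ ∧ ∀ x ∈ U₀, IsLeast (range fun j => sqDist (N j) x) (sqDist M x)

end

end MedialAxis

/-! Write `δ` for the squared distance to `M` and `δ_j` for that to its piece near `y j`. At `x₀`
this piece has the single nearest point `y j`, so `δ_j` is strictly differentiable there with
gradient `2(x₀ - y j)` (`hasStrictFDerivAt_sqDist`), although it may fail to be C¹ nearby. The
differences of these gradients are `2(y i - y j)`. Distinct points of a sphere, non-concyclic if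
there are four, are affinely independent (`affineIndependent_of_cospherical`), so `(δ_j)_j` modulo
the diagonal has surjective derivative. Linear coordinates transverse to the span of the `y i - y j`
complete it to a map with invertible strict derivative, and the inverse function theorem makes that
map locally bilipschitz.

The two conflict sets then match because both are determined by the order of the coordinates: a
point of the simplex lies on the axis iff its least coordinate is attained twice
(`mem_simplexAxis_iff`), and `x` is in conflict iff the least `δ_j x` is attained twice. Projecting
away the diagonal, translating to the centre and scaling by a positive factor all preserve that
order. -/

namespace MedialAxis

/-! ### Nearest points and the derivative of the squared distance -/

section ClosestPoints

theorem mem_closestPoints_iff {X : Type*} [PseudoMetricSpace X] {M : Set X} {x p : X} :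
    p ∈ closestPoints M x ↔ p ∈ M ∧ ∀ q ∈ M, dist x p ≤ dist x q := by
  constructor
  · rintro ⟨hp, h⟩
    exact ⟨hp, fun q hq => h ▸ Metric.infDist_le_dist_of_mem hq⟩
  · rintro ⟨hp, h⟩
    exact ⟨hp, le_antisymm ((Metric.le_infDist ⟨p, hp⟩).2 fun {q} hq => h q hq)
      (Metric.infDist_le_dist_of_mem hp)⟩

theorem closestPoints_nonempty {X : Type*} [MetricSpace X] [ProperSpace X] {M : Set X}
    (hM : IsClosed M) (hne : M.Nonempty) (x : X) : (closestPoints M x).Nonempty := by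
  obtain ⟨p, hp, h⟩ := hM.exists_infDist_eq_dist hne x
  exact ⟨p, hp, h.symm⟩

/-- Upper semicontinuity of the set of closest points. -/
theorem eventually_closestPoints_subset {X : Type*} [MetricSpace X] [ProperSpace X] {M : Set X}
    (hM : IsClosed M) {x₀ : X} {O : Set X} (hO : IsOpen O) (h : closestPoints M x₀ ⊆ O) :
    ∀ᶠ x in 𝓝 x₀, closestPoints M x ⊆ O := by
  have hR : IsClosed (M \ O) := hM.sdiff hO
  rcases (M \ O).eq_empty_or_nonempty with he | hne
  · exact .of_forall fun x p hp => sdiff_eq_empty.1 he hp.1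
  · have hlt : Metric.infDist x₀ M < Metric.infDist x₀ (M \ O) := by
      obtain ⟨p, hp, hpd⟩ := hR.exists_infDist_eq_dist hne x₀
      rw [hpd]
      refine lt_of_le_of_ne (Metric.infDist_le_dist_of_mem hp.1) fun heq => hp.2 (h ⟨hp.1, heq.symm⟩)
    filter_upwards [(Metric.continuous_infDist_pt M).continuousAt.eventually_lt
      (Metric.continuous_infDist_pt (M \ O)).continuousAt hlt] with x hx p hp
    by_contra hpO
    have := Metric.infDist_le_dist_of_mem (x := x) (s := M \ O) ⟨hp.1, hpO⟩
    rw [hp.2] at this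
    exact absurd hx this.not_gt

/-- Near a point with finitely many closest points, the distance is the least of the distances to
the localizations of the set at these closest points. -/
theorem exists_isAdmissibleNhd {X ι : Type*} [MetricSpace X] [ProperSpace X] {M : Set X}
    (hM : IsClosed M) {x₀ : X} {y : ι → X} (hne : M.Nonempty)
    (hm : closestPoints M x₀ = range y) {W : ι → Set X} (hW : ∀ j, W j ∈ 𝓝 (y j)) :
    ∃ U₀, IsAdmissibleNhd M (fun j => M ∩ closure (W j)) x₀ U₀ := by
  have hyM : ∀ j, y j ∈ M := fun j => (hm.symm ▸ mem_range_self j : y j ∈ closestPoints M x₀).1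
  have hev := eventually_closestPoints_subset hM (x₀ := x₀) (O := ⋃ j, interior (W j))
    (isOpen_iUnion fun _ => isOpen_interior) (by
      rw [hm]
      rintro _ ⟨j, rfl⟩
      exact mem_iUnion.2 ⟨j, mem_interior_iff_mem_nhds.2 (hW j)⟩)
  refine ⟨_, hev, fun x hx => ?_⟩
  have hle : ∀ j, Metric.infDist x M ≤ Metric.infDist x (M ∩ closure (W j)) := fun j =>
    Metric.infDist_le_infDist_of_subset inter_subset_left
      ⟨y j, hyM j, subset_closure (mem_of_mem_nhds (hW j))⟩
  constructor
  · obtain ⟨p, hp⟩ := closestPoints_nonempty hM hne x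
    obtain ⟨j, hj⟩ := mem_iUnion.1 (hx hp)
    refine ⟨j, ?_⟩
    have := Metric.infDist_le_dist_of_mem (x := x) (s := M ∩ closure (W j))
      ⟨hp.1, subset_closure (interior_subset hj)⟩
    rw [hp.2] at this
    simp only [sqDist, le_antisymm this (hle j)]
  · rintro _ ⟨j, rfl⟩
    exact pow_le_pow_left₀ Metric.infDist_nonneg (hle j) 2

/-- Disjointness of the `V j` keeps every other nearest point out of `closure (W j)`; this supplies
the uniqueness needed to differentiate `δ_j`. -/
theorem closestPoints_inter_closure {X ι : Type*} [MetricSpace X] {M : Set X}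
    {x₀ : X} {y : ι → X} (hm : closestPoints M x₀ = range y) {V W : ι → Set X}
    (hV : Pairwise fun i j => Disjoint (V i) (V j)) (hW : ∀ j, W j ∈ 𝓝 (y j))
    (hWV : ∀ j, closure (W j) ⊆ V j) (j : ι) :
    closestPoints (M ∩ closure (W j)) x₀ = {y j} := by
  have hy : ∀ j, y j ∈ closestPoints M x₀ := fun j => hm.symm ▸ mem_range_self j
  have hyW : ∀ j, y j ∈ closure (W j) := fun j => subset_closure (mem_of_mem_nhds (hW j))
  have hyj := mem_closestPoints_iff.1 (hy j)
  ext p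
  rw [mem_closestPoints_iff, mem_singleton_iff]
  constructor
  · rintro ⟨⟨hp, hpW⟩, hle⟩
    have hp' : p ∈ closestPoints M x₀ :=
      mem_closestPoints_iff.2 ⟨hp, fun q hq => (hle _ ⟨hyj.1, hyW j⟩).trans (hyj.2 q hq)⟩
    obtain ⟨i, rfl⟩ := hm ▸ hp'
    by_contra hne
    have hij : i ≠ j := fun h => hne (h ▸ rfl)
    exact (hV hij).le_bot ⟨hWV i (hyW i), hWV j hpW⟩
  · rintro rfl
    exact ⟨⟨hyj.1, hyW j⟩, fun q hq => hyj.2 q hq.1⟩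

variable {E : Type*} [NormedAddCommGroup E] [InnerProductSpace ℝ E]

theorem dist_sq_sub_dist_sq (x x' p : E) :
    dist x p ^ 2 - dist x' p ^ 2 = inner ℝ (x + x' - (2 : ℝ) • p) (x - x') := by
  rw [dist_eq_norm, dist_eq_norm, ← real_inner_self_eq_norm_sq, ← real_inner_self_eq_norm_sq]
  simp only [inner_sub_left, inner_sub_right, inner_add_left, inner_smul_left,
    real_inner_comm x x', real_inner_comm x p, real_inner_comm x' p]
  simp
  ring

/-- A nearest point of `x'` is a competitor for `x`. Used in both directions, this one-sided bound
controls the increment from above and below. -/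
theorem sqDist_sub_sqDist_le {N : Set E} {x x' p : E} (hp : p ∈ closestPoints N x') :
    sqDist N x - sqDist N x' ≤ inner ℝ (x + x' - (2 : ℝ) • p) (x - x') := by
  rw [← dist_sq_sub_dist_sq, sqDist, sqDist, ← hp.2]
  have := pow_le_pow_left₀ Metric.infDist_nonneg (Metric.infDist_le_dist_of_mem (x := x) hp.1) 2
  linarith

/-- The squared distance function is strictly differentiable at every point with a unique closest
point. -/
theorem hasStrictFDerivAt_sqDist [ProperSpace E] {N : Set E} (hN : IsClosed N) {x₀ y : E}
    (h : closestPoints N x₀ = {y}) :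
    HasStrictFDerivAt (sqDist N) (innerSL ℝ ((2 : ℝ) • (x₀ - y))) x₀ := by
  have hne : N.Nonempty := ⟨y, (h.symm ▸ mem_singleton y : y ∈ closestPoints N x₀).1⟩
  refine .of_isLittleO (Asymptotics.isLittleO_iff.2 fun ε hε => ?_)
  -- The error vector is `(x - x₀) + (x' - x₀) - 2(p - y)`, whence `ε/4 + ε/4 + 2 · ε/4 = ε`.
  have hcl := eventually_closestPoints_subset hN (x₀ := x₀) (O := Metric.ball y (ε / 4))
    Metric.isOpen_ball (by rw [h]; simpa using by positivity)
  have hball : ∀ᶠ x in 𝓝 x₀, x ∈ Metric.ball x₀ (ε / 4) :=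
    Metric.ball_mem_nhds _ (by positivity)
  have key : ∀ x x', x ∈ Metric.ball x₀ (ε / 4) → x' ∈ Metric.ball x₀ (ε / 4) →
      closestPoints N x' ⊆ Metric.ball y (ε / 4) →
      sqDist N x - sqDist N x' - inner ℝ ((2 : ℝ) • (x₀ - y)) (x - x') ≤ ε * ‖x - x'‖ := by
    intro x x' hx hx' hp
    obtain ⟨p, hpc⟩ := closestPoints_nonempty hN hne x'
    have hpy := hp hpc
    rw [mem_ball_iff_norm] at hx hx' hpy
    refine (sub_le_sub_right (sqDist_sub_sqDist_le hpc) _).trans ?_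
    rw [← inner_sub_left]
    refine (real_inner_le_norm _ _).trans ?_
    gcongr
    have : x + x' - (2 : ℝ) • p - (2 : ℝ) • (x₀ - y) = (x - x₀) + (x' - x₀) - (2 : ℝ) • (p - y) := by
      module
    rw [this]
    refine (norm_sub_le _ _).trans ((add_le_add_left (norm_add_le _ _) _).trans ?_)
    rw [norm_smul, Real.norm_ofNat]
    linarith
  rw [nhds_prod_eq]
  filter_upwards [(hcl.and hball).prod_mk (hcl.and hball)] with ⟨x, x'⟩ ⟨⟨hx1, hx2⟩, ⟨hx'1, hx'2⟩⟩
  simp only [innerSL_apply_apply, Real.norm_eq_abs]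
  rw [abs_le]
  have h1 := key x x' hx2 hx'2 hx'1
  have h2 := key x' x hx'2 hx2 hx1
  rw [norm_sub_rev, ← neg_sub x x', inner_neg_right] at h2
  constructor <;> linarith

end ClosestPoints

/-! ### The medial axis of the boundary of the simplex -/

section Simplex

noncomputable section

variable {k : ℕ}

/-- The orthogonal projection of a point of the simplex to the `i`-th facet. -/
def facetFoot (t : EuclideanSpace ℝ (Fin k)) (i : Fin k) : EuclideanSpace ℝ (Fin k) :=
  WithLp.toLp 2 fun l => if l = i then 0 else t l + t i / (k - 1)

theorem facetFoot_apply_self (t : EuclideanSpace ℝ (Fin k)) (i : Fin k) :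
    facetFoot t i i = 0 := by
  simp [facetFoot]

theorem facetFoot_apply_of_ne (t : EuclideanSpace ℝ (Fin k)) {i l : Fin k} (h : l ≠ i) :
    facetFoot t i l = t l + t i / (k - 1) := by
  simp [facetFoot, h]

theorem sum_erase_const (i : Fin k) (a : ℝ) :
    ∑ _l ∈ Finset.univ.erase i, a = (k - 1) * a := by
  have : 1 ≤ k := Fin.pos i
  rw [Finset.sum_const, Finset.card_erase_of_mem (Finset.mem_univ i), Finset.card_univ,
    Fintype.card_fin, nsmul_eq_mul]
  push_cast [this]
  ring

theorem facetFoot_sum (hk : 2 ≤ k) {t : EuclideanSpace ℝ (Fin k)} (ht : ∑ i, t i = 1)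
    (i : Fin k) : ∑ l, facetFoot t i l = 1 := by
  have hk1 : (0 : ℝ) < k - 1 := by
    have : (2 : ℝ) ≤ k := by exact_mod_cast hk
    linarith
  have h : ∀ l ∈ Finset.univ.erase i, facetFoot t i l = t l + t i / (k - 1) := fun l hl =>
    facetFoot_apply_of_ne t (Finset.ne_of_mem_erase hl)
  rw [← Finset.add_sum_erase _ _ (Finset.mem_univ i), facetFoot_apply_self,
    Finset.sum_congr rfl h, Finset.sum_add_distrib, sum_erase_const, mul_div_cancel₀ _ hk1.ne', zero_add, add_comm,
    Finset.add_sum_erase _ _ (Finset.mem_univ i), ht]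

theorem facetFoot_pos (hk : 2 ≤ k) {t : EuclideanSpace ℝ (Fin k)} (ht : ∀ i, 0 < t i)
    {i l : Fin k} (h : l ≠ i) : 0 < facetFoot t i l := by
  have hk1 : (0 : ℝ) < k - 1 := by
    have : (2 : ℝ) ≤ k := by exact_mod_cast hk
    linarith
  rw [facetFoot_apply_of_ne t h]
  have := ht l
  have := ht i
  positivity

theorem facetFoot_mem_simplexBoundary (hk : 2 ≤ k) {t : EuclideanSpace ℝ (Fin k)}
    (ht : t ∈ openSimplex k) (i : Fin k) : facetFoot t i ∈ simplexBoundary k := by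
  refine ⟨fun l => ?_, facetFoot_sum hk ht.2 i, i, facetFoot_apply_self t i⟩
  by_cases h : l = i
  · rw [h, facetFoot_apply_self]
  · exact (facetFoot_pos hk ht.1 h).le

/-- Pythagoras' theorem for the projection to a facet. -/
theorem dist_sq_eq_of_apply_eq_zero (hk : 2 ≤ k) {t s : EuclideanSpace ℝ (Fin k)}
    (ht : ∑ i, t i = 1) (hs : ∑ i, s i = 1) {i : Fin k} (hsi : s i = 0) :
    dist t s ^ 2 = t i ^ 2 * (k / (k - 1)) + dist s (facetFoot t i) ^ 2 := by
  have hk1 : (0 : ℝ) < k - 1 := by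
    have : (2 : ℝ) ≤ k := by exact_mod_cast hk
    linarith
  rw [← Finset.add_sum_erase _ _ (Finset.mem_univ i)] at ht hs
  rw [EuclideanSpace.dist_sq_eq, EuclideanSpace.dist_sq_eq,
    ← Finset.add_sum_erase _ _ (Finset.mem_univ i),
    ← Finset.add_sum_erase _ (fun l => dist (s l) (facetFoot t i l) ^ 2) (Finset.mem_univ i)]
  have h1 : ∀ l ∈ Finset.univ.erase i, dist (s l) (facetFoot t i l) ^ 2 =
      dist (t l) (s l) ^ 2 + (2 * (t i / (k - 1))) * t l - (2 * (t i / (k - 1))) * s l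
        + (t i / (k - 1)) ^ 2 := by
    intro l hl
    rw [facetFoot_apply_of_ne t (Finset.ne_of_mem_erase hl), Real.dist_eq, Real.dist_eq, sq_abs,
      sq_abs]
    ring
  rw [Finset.sum_congr rfl h1, Finset.sum_add_distrib, Finset.sum_sub_distrib,
    Finset.sum_add_distrib, ← Finset.mul_sum, ← Finset.mul_sum, sum_erase_const,
    facetFoot_apply_self, hsi, dist_self, Real.dist_eq, sq_abs]
  rw [eq_sub_of_add_eq' ht, eq_sub_of_add_eq' hs, hsi]
  field_simp
  ring

/-- The foot on the `i`-th facet lies in the boundary at squared distance `t i ^ 2 * (k / (k - 1))`.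
By Pythagoras the nearest boundary points are exactly the feet on the facets whose coordinate is
least. -/
theorem mem_simplexAxis_iff (hk : 2 ≤ k) {t : EuclideanSpace ℝ (Fin k)} :
    t ∈ simplexAxis k ↔
      t ∈ openSimplex k ∧ ∃ i j, i ≠ j ∧ t i = t j ∧ ∀ l, t j ≤ t l := by
  have hC : (0 : ℝ) < k / (k - 1) := by
    have : (2 : ℝ) ≤ k := by exact_mod_cast hk
    exact div_pos (by linarith) (by linarith)
  rw [simplexAxis, mem_inter_iff, and_comm]
  refine and_congr_right fun ht => ?_
  have hfoot : ∀ i, dist t (facetFoot t i) ^ 2 = t i ^ 2 * (k / (k - 1)) := fun i => by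
    rw [dist_sq_eq_of_apply_eq_zero hk ht.2 (facetFoot_sum hk ht.2 i) (facetFoot_apply_self t i),
      dist_self]
    ring
  constructor
  · have key : ∀ s ∈ closestPoints (simplexBoundary k) t,
        ∃ i, s = facetFoot t i ∧ ∀ l, t i ≤ t l := by
      intro s hs
      obtain ⟨⟨-, hs1, i, hi⟩, hmin⟩ := mem_closestPoints_iff.1 hs
      have hle : ∀ l, t i ^ 2 * (k / (k - 1)) + dist s (facetFoot t i) ^ 2 ≤
          t l ^ 2 * (k / (k - 1)) := fun l => by
        rw [← dist_sq_eq_of_apply_eq_zero hk ht.2 hs1 hi, ← hfoot]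
        exact pow_le_pow_left₀ dist_nonneg (hmin _ (facetFoot_mem_simplexBoundary hk ht l)) 2
      refine ⟨i, ?_, fun l => ?_⟩
      · have := hle i
        have h0 : dist s (facetFoot t i) ^ 2 = 0 := le_antisymm (by linarith) (sq_nonneg _)
        exact dist_eq_zero.1 (pow_eq_zero_iff two_ne_zero |>.1 h0)
      · have h1 := hle l
        have h2 := sq_nonneg (dist s (facetFoot t i))
        refine (sq_le_sq₀ (ht.1 i).le (ht.1 l).le).1 (le_of_mul_le_mul_right ?_ hC)
        linarith
    rintro ⟨s, hs, s', hs', hne⟩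
    obtain ⟨i, rfl, hi⟩ := key s hs
    obtain ⟨j, rfl, hj⟩ := key s' hs'
    exact ⟨i, j, fun h => hne (h ▸ rfl), le_antisymm (hi j) (hj i), hj⟩
  · rintro ⟨i, j, hij, heq, hmin⟩
    have key : ∀ i, (∀ l, t i ≤ t l) → facetFoot t i ∈ closestPoints (simplexBoundary k) t := by
      intro i hi
      refine mem_closestPoints_iff.2 ⟨facetFoot_mem_simplexBoundary hk ht i, ?_⟩
      rintro s ⟨-, hs, l, hl⟩
      refine (sq_le_sq₀ dist_nonneg dist_nonneg).1 ?_
      rw [hfoot, dist_sq_eq_of_apply_eq_zero hk ht.2 hs hl]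
      have h1 : t i ^ 2 ≤ t l ^ 2 := pow_le_pow_left₀ (ht.1 i).le (hi l) 2
      have h2 := sq_nonneg (dist s (facetFoot t l))
      nlinarith
    refine ⟨_, key i (heq ▸ hmin), _, key j hmin, fun h => ?_⟩
    -- The feet differ: coordinate `i` vanishes at the first and is positive at the second.
    have := facetFoot_pos hk ht.1 hij
    rw [← h, facetFoot_apply_self] at this
    exact this.false

end

end Simplex

/-! ### A bilipschitz inverse function theorem with prescribed image -/

section LocalInverse

/-- A map with invertible strict derivative at a zero `a` is, after rescaling, a bilipschitz map of
arbitrarily small neighbourhoods of `a` onto a given bounded open neighbourhood of the origin. -/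
theorem exists_isBilipschitzOnto_smul {E F : Type*} [NormedAddCommGroup E] [NormedSpace ℝ E]
    [CompleteSpace E] [NormedAddCommGroup F] [NormedSpace ℝ F] {f : E → F} {f' : E ≃L[ℝ] F} {a : E}
    (hf : HasStrictFDerivAt f (f' : E →L[ℝ] F) a) (hfa : f a = 0) {T : Set F} (hT : IsOpen T)
    (hT0 : (0 : F) ∈ T) (hTb : Bornology.IsBounded T) {U₀ : Set E} (hU₀ : U₀ ∈ 𝓝 a) :
    ∃ U : Set E, IsOpen U ∧ a ∈ U ∧ U ⊆ U₀ ∧ ∃ r : ℝ, 0 < r ∧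
      IsBilipschitzOnto (fun x => r • f x) U T := by
  obtain ⟨s, has, hso, hs⟩ := hf.approximates_deriv_on_open_nhds
  -- If `E` is trivial the norm is zero and the strict inequality fails, hence the alternative.
  have hc : Subsingleton E ∨ ‖(f'.symm : F →L[ℝ] E)‖₊⁻¹ / 2 < ‖(f'.symm : F →L[ℝ] E)‖₊⁻¹ :=
    f'.subsingleton_or_nnnorm_symm_pos.imp id fun h => NNReal.half_lt_self (inv_pos.2 h).ne'
  set O := s ∩ interior U₀ with hO
  have hOo : IsOpen O := hso.inter isOpen_interior
  have haO : a ∈ O := ⟨has, mem_interior_iff_mem_nhds.2 hU₀⟩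
  have himage : f '' O ∈ 𝓝 (0 : F) := by
    rw [← hfa, ← hf.map_nhds_eq_of_equiv]
    exact Filter.image_mem_map (hOo.mem_nhds haO)
  obtain ⟨ε, hε, hεO⟩ := Metric.mem_nhds_iff.1 himage
  obtain ⟨R, hR, hTR⟩ := hTb.subset_ball_lt 0 (0 : F)
  -- Since `f '' O` contains the ball of radius `ε` and `T` lies in that of radius `R`, scaling by
  -- `R / ε` makes the image cover `T`.
  have hr : 0 < R / ε := by positivity
  obtain ⟨K₁, hK₁⟩ : ∃ K, LipschitzWith K (s.domRestrict f) := ⟨_, hs.lipschitz⟩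
  obtain ⟨K₂, hK₂⟩ : ∃ K, AntilipschitzWith K (s.domRestrict f) := ⟨_, hs.antilipschitz hc⟩
  have hdist : ∀ x y, dist ((R / ε) • f x) ((R / ε) • f y) = R / ε * dist (f x) (f y) :=
    fun x y => by rw [dist_smul₀, Real.norm_of_nonneg hr.le]
  refine ⟨O ∩ (fun x => (R / ε) • f x) ⁻¹' T, ?_, ?_, ?_, R / ε, hr, ?_, ?_⟩
  · exact ((hs.continuousOn.mono inter_subset_left).const_smul _).isOpen_inter_preimage hOo hT
  · exact ⟨haO, by simpa [hfa] using hT0⟩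
  · exact fun x hx => interior_subset hx.1.2
  · refine Subset.antisymm (by rintro _ ⟨x, hx, rfl⟩; exact hx.2) fun z hz => ?_
    have hzε : (R / ε)⁻¹ • z ∈ Metric.ball (0 : F) ε := by
      have := hTR hz
      rw [mem_ball_zero_iff] at this ⊢
      rw [norm_smul, norm_inv, Real.norm_of_nonneg hr.le, inv_div, div_mul_eq_mul_div,
        div_lt_iff₀ hR]
      gcongr
    obtain ⟨x, hx, hxz⟩ := hεO hzε
    have hxz' : (R / ε) • f x = z := by rw [hxz, smul_inv_smul₀ hr.ne']
    exact ⟨x, ⟨hx, by simpa only [mem_preimage, hxz'] using hz⟩, hxz'⟩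
  · refine ⟨max (Real.toNNReal (R / ε) * K₁) (K₂ * Real.toNNReal (R / ε)⁻¹),
      LipschitzOnWith.of_dist_le_mul fun x hx y hy => ?_, fun x hx y hy => ?_⟩
    · rw [hdist]
      have h := hK₁.dist_le_mul ⟨x, hx.1.1⟩ ⟨y, hy.1.1⟩
      simp only [domRestrict_apply, Subtype.dist_eq] at h
      calc R / ε * dist (f x) (f y) ≤ R / ε * (K₁ * dist x y) := by gcongr
        _ = ((Real.toNNReal (R / ε) * K₁ : ℝ≥0) : ℝ) * dist x y := by
          rw [NNReal.coe_mul, Real.coe_toNNReal _ hr.le, mul_assoc]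
        _ ≤ _ := by
          gcongr
          exact_mod_cast le_max_left _ _
    · rw [hdist]
      have h := hK₂.le_mul_dist ⟨x, hx.1.1⟩ ⟨y, hy.1.1⟩
      simp only [domRestrict_apply, Subtype.dist_eq] at h
      calc dist x y ≤ K₂ * dist (f x) (f y) := h
        _ = ((K₂ * Real.toNNReal (R / ε)⁻¹ : ℝ≥0) : ℝ) * (R / ε * dist (f x) (f y)) := by
          rw [NNReal.coe_mul, Real.coe_toNNReal _ (inv_nonneg.2 hr.le)]
          field_simp
        _ ≤ _ := by
          gcongr
          exact_mod_cast le_max_right _ _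

theorem IsBilipschitzOnto.isometry_comp {X Y Z : Type*} [MetricSpace X] [MetricSpace Y]
    [MetricSpace Z] {φ : X → Y} {U : Set X} {T : Set Y} (h : IsBilipschitzOnto φ U T) {g : Y → Z}
    (hg : Isometry g) : IsBilipschitzOnto (g ∘ φ) U (g '' T) := by
  obtain ⟨himage, K, hK, hK'⟩ := h
  refine ⟨by rw [image_comp, himage], K, ?_, fun x hx y hy => ?_⟩
  · simpa using hg.lipschitz.comp_lipschitzOnWith hK
  · simpa [hg.dist_eq] using hK' x hx y hy

end LocalInverse

/-! ### Projection along the diagonal -/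

section SumZero

noncomputable section

variable {k : ℕ}

/-- The vector `(1, …, 1)`. -/
def ones (k : ℕ) : EuclideanSpace ℝ (Fin k) := WithLp.toLp 2 fun _ => 1

/-- The hyperplane of vectors with coordinate sum zero. -/
abbrev sumZero (k : ℕ) : Submodule ℝ (EuclideanSpace ℝ (Fin k)) := (ℝ ∙ ones k)ᗮ

theorem mem_sumZero_iff {u : EuclideanSpace ℝ (Fin k)} : u ∈ sumZero k ↔ ∑ i, u i = 0 := by
  rw [Submodule.mem_orthogonal_singleton_iff_inner_right, PiLp.inner_apply]
  simp [ones]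

theorem finrank_sumZero_add_one (hk : k ≠ 0) : Module.finrank ℝ (sumZero k) + 1 = k := by
  have hne : ones k ≠ 0 := fun h => by
    have := congrArg (fun u : EuclideanSpace ℝ (Fin k) => u ⟨0, Nat.pos_of_ne_zero hk⟩) h
    simp [ones] at this
  have := Submodule.finrank_add_finrank_orthogonal (ℝ ∙ ones k)
  rw [finrank_span_singleton hne, finrank_euclideanSpace_fin] at this
  rw [add_comm]
  exact this

/-- The orthogonal projection to the vectors with coordinate sum zero. -/
def toSumZero (k : ℕ) : EuclideanSpace ℝ (Fin k) →L[ℝ] sumZero k :=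
  (sumZero k).orthogonalProjectionOnto

/-- The projection only subtracts a multiple of `ones k`, so all comparisons between coordinates
survive it. -/
theorem toSumZero_sub_apply (u : EuclideanSpace ℝ (Fin k)) (i j : Fin k) :
    (toSumZero k u : EuclideanSpace ℝ (Fin k)) i - (toSumZero k u : EuclideanSpace ℝ (Fin k)) j =
      u i - u j := by
  have h : u - toSumZero k u ∈ (sumZero k)ᗮ := Submodule.sub_starProjection_mem_orthogonal u
  rw [Submodule.orthogonal_orthogonal, Submodule.mem_span_singleton] at h
  obtain ⟨c, hc⟩ := h
  have hi := congrArg (fun u : EuclideanSpace ℝ (Fin k) => u i) hc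
  have hj := congrArg (fun u : EuclideanSpace ℝ (Fin k) => u j) hc
  simp only [ones, PiLp.smul_apply, PiLp.sub_apply, smul_eq_mul] at hi hj
  linarith

theorem toSumZero_eq_zero_iff {u : EuclideanSpace ℝ (Fin k)} :
    toSumZero k u = 0 ↔ ∀ i j, u i = u j := by
  constructor
  · intro h i j
    have := toSumZero_sub_apply u i j
    rw [h] at this
    simp at this
    linarith
  · intro h
    have hu : u ∈ ℝ ∙ ones k := by
      rcases isEmpty_or_nonempty (Fin k) with he | ⟨⟨i⟩⟩
      · rw [Subsingleton.elim u 0]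
        exact zero_mem _
      · refine Submodule.mem_span_singleton.2 ⟨u i, ?_⟩
        ext j
        simp [ones, h i j]
    refine Submodule.orthogonalProjectionOnto_apply_of_mem_orthogonal ?_
    rwa [Submodule.orthogonal_orthogonal]

end

end SumZero

/-! ### The chart and the conflict set -/

section Chart

noncomputable section

variable {k d : ℕ}

/-- The translation moving the origin to the centre of the product of the simplex and the cube. -/
def translateToCentre (k d : ℕ) (p : sumZero k × EuclideanSpace ℝ (Fin d)) :
    EuclideanSpace ℝ (Fin k) × EuclideanSpace ℝ (Fin d) :=
  (simplexCentre k + p.1, cubeCentre d + p.2)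

theorem isometry_translateToCentre : Isometry (translateToCentre k d) :=
  Isometry.of_dist_eq fun p q => by simp [translateToCentre, Prod.dist_eq, Subtype.dist_eq]

theorem simplexCentre_sum (hk : k ≠ 0) : ∑ i, simplexCentre k i = 1 := by
  simp [simplexCentre, hk]

theorem translateToCentre_fst_sum (hk : k ≠ 0) (p : sumZero k × EuclideanSpace ℝ (Fin d)) :
    ∑ i, (translateToCentre k d p).1 i = 1 := by
  simp only [translateToCentre, PiLp.add_apply, Finset.sum_add_distrib, simplexCentre_sum hk,
    mem_sumZero_iff.1 p.1.2, add_zero]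

theorem openSimplex_prod_openCube_subset_range (hk : k ≠ 0) :
    openSimplex k ×ˢ openCube d ⊆ range (translateToCentre k d) := by
  rintro ⟨t, s⟩ ⟨ht, -⟩
  have hmem : t - simplexCentre k ∈ sumZero k := by
    rw [mem_sumZero_iff]
    simp only [PiLp.sub_apply, Finset.sum_sub_distrib, simplexCentre_sum hk, ht.2, sub_self]
  exact ⟨(⟨t - simplexCentre k, hmem⟩, s - cubeCentre d), by simp [translateToCentre]⟩

/-- The simplex is not open in the ambient space, but on translates of `sumZero k` its equation
holds automatically and only strict inequalities remain. -/
theorem isOpen_preimage_translateToCentre (hk : k ≠ 0) :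
    IsOpen (translateToCentre k d ⁻¹' (openSimplex k ×ˢ openCube d)) := by
  have h : translateToCentre k d ⁻¹' (openSimplex k ×ˢ openCube d) =
      translateToCentre k d ⁻¹' ({t | ∀ i, 0 < t i} ×ˢ openCube d) := by
    ext p
    simp [openSimplex, translateToCentre_fst_sum hk p]
  rw [h]
  refine IsOpen.preimage isometry_translateToCentre.continuous (IsOpen.prod ?_ ?_)
  · rw [ofPred_forall]
    exact isOpen_iInter_of_finite fun i => isOpen_lt continuous_const (by fun_prop)
  · rw [openCube, ofPred_forall]
    exact isOpen_iInter_of_finite fun i => isOpen_Ioo.preimage (by fun_prop)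

theorem isBounded_openSimplex : Bornology.IsBounded (openSimplex k) := by
  refine isBounded_iff_forall_norm_le.2 ⟨1, fun t ht => ?_⟩
  rw [EuclideanSpace.norm_eq, Real.sqrt_le_iff, and_iff_right zero_le_one, one_pow, ← ht.2]
  refine Finset.sum_le_sum fun i _ => ?_
  have h1 : t i ≤ 1 :=
    ht.2 ▸ Finset.single_le_sum (fun j _ => (ht.1 j).le) (Finset.mem_univ i)
  rw [Real.norm_eq_abs, sq_abs]
  nlinarith [ht.1 i]

theorem isBounded_openCube : Bornology.IsBounded (openCube d) := by
  refine isBounded_iff_forall_norm_le.2 ⟨Real.sqrt d, fun s hs => ?_⟩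
  rw [EuclideanSpace.norm_eq]
  refine Real.sqrt_le_sqrt ((Finset.sum_le_sum fun i _ => ?_).trans_eq (b := ∑ _i : Fin d, (1 : ℝ))
    (by simp))
  have := hs i
  rw [Real.norm_eq_abs, sq_abs]
  nlinarith [this.1, this.2]

theorem translateToCentre_zero : translateToCentre k d 0 = (simplexCentre k, cubeCentre d) := by
  simp [translateToCentre]

theorem centre_mem (hk : k ≠ 0) :
    (simplexCentre k, cubeCentre d) ∈ openSimplex k ×ˢ openCube d := by
  refine ⟨⟨fun i => ?_, simplexCentre_sum hk⟩, fun i => ?_⟩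
  · simp [simplexCentre, Nat.pos_of_ne_zero hk]
  · norm_num [cubeCentre]

variable {E : Type*} [NormedAddCommGroup E] [InnerProductSpace ℝ E] [FiniteDimensional ℝ E]

/-- The linear map `v ↦ (⟪a j, v⟫)_j`. -/
def innerVec (a : Fin k → E) : E →L[ℝ] EuclideanSpace ℝ (Fin k) :=
  (EuclideanSpace.equiv (Fin k) ℝ).symm.toContinuousLinearMap ∘L
    ContinuousLinearMap.pi fun j => innerSL ℝ (a j)

/-- If the points `y j` are affinely independent, then the map `v ↦ (2⟪x₀ - y j, v⟫)_j`, projected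
to the vectors with coordinate sum zero, extends to a linear isomorphism. -/
theorem exists_complementing_map (hd : Module.finrank ℝ E + 1 = k + d) (hk : k ≠ 0) {y : Fin k → E}
    (hy : AffineIndependent ℝ y) (x₀ : E) :
    ∃ (q : E →L[ℝ] EuclideanSpace ℝ (Fin d)) (B : E ≃L[ℝ] sumZero k × EuclideanSpace ℝ (Fin d)),
      (B : E →L[ℝ] sumZero k × EuclideanSpace ℝ (Fin d)) =
        (toSumZero k ∘L innerVec fun j => (2 : ℝ) • (x₀ - y j)).prod q := by
  set S := vectorSpan ℝ (range y) with hS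
  have hcard : Fintype.card (Fin k) = (k - 1) + 1 := by
    rw [Fintype.card_fin]
    omega
  have hfS : Module.finrank ℝ S = k - 1 := hy.finrank_vectorSpan hcard
  have hfSo : Module.finrank ℝ Sᗮ = Module.finrank ℝ (EuclideanSpace ℝ (Fin d)) := by
    have := S.finrank_add_finrank_orthogonal
    rw [finrank_euclideanSpace_fin]
    omega
  let e : Sᗮ ≃L[ℝ] EuclideanSpace ℝ (Fin d) := ContinuousLinearEquiv.ofFinrankEq hfSo
  let q : E →L[ℝ] EuclideanSpace ℝ (Fin d) := e.toContinuousLinearMap ∘L Sᗮ.orthogonalProjectionOnto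
  let L : E →L[ℝ] sumZero k × EuclideanSpace ℝ (Fin d) :=
    (toSumZero k ∘L innerVec fun j => (2 : ℝ) • (x₀ - y j)).prod q
  have hinj : Function.Injective L := by
    rw [injective_iff_map_eq_zero]
    intro v hv
    obtain ⟨h1, h2⟩ := Prod.ext_iff.1 hv
    have h1' := toSumZero_eq_zero_iff.1 h1
    -- Equal coordinates of the first component mean that `v` is orthogonal to all `y i - y j`; `q`
    -- is injective on the orthogonal complement of their span.
    have hvS : v ∈ Sᗮ := by
      rw [hS, vectorSpan_def, Submodule.mem_orthogonal]
      intro u hu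
      induction hu using Submodule.span_induction with
      | mem u hu =>
        obtain ⟨_, ⟨i, rfl⟩, _, ⟨j, rfl⟩, rfl⟩ := hu
        have : inner ℝ ((2 : ℝ) • (x₀ - y i)) v = inner ℝ ((2 : ℝ) • (x₀ - y j)) v := h1' i j
        simp only [inner_smul_left, inner_sub_left] at this
        simp only [vsub_eq_sub, inner_sub_left]
        simp at this
        linarith
      | zero => simp
      | add a b _ _ ha hb => rw [inner_add_left, ha, hb, add_zero]
      | smul c a _ ha => rw [inner_smul_left, ha, mul_zero]
    have h3 : Sᗮ.orthogonalProjectionOnto v = 0 := e.map_eq_zero_iff.1 h2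
    rw [Submodule.orthogonalProjectionOnto_eq_zero_iff] at h3
    exact inner_self_eq_zero.1 (Submodule.mem_orthogonal _ _ |>.1 h3 v hvS)
  have hfr : Module.finrank ℝ E = Module.finrank ℝ (sumZero k × EuclideanSpace ℝ (Fin d)) := by
    have := finrank_sumZero_add_one hk
    rw [Module.finrank_prod, finrank_euclideanSpace_fin]
    omega
  refine ⟨q, (LinearEquiv.ofInjectiveOfFinrankEq L.toLinearMap hinj hfr).toContinuousLinearEquiv, ?_⟩
  ext v : 1
  rfl

/-- Yomdin's local structure theorem for the conflict set of affinely independent closest points in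
a Euclidean space of any dimension. -/
theorem exists_chart_conflictSet (hk : 2 ≤ k) (hd : Module.finrank ℝ E + 1 = k + d)
    {M : Set E} (hM : IsClosed M) {x₀ : E} {y : Fin k → E} (hm : closestPoints M x₀ = range y)
    (hy : AffineIndependent ℝ y) {V W : Fin k → Set E}
    (hV : Pairwise fun i j => Disjoint (V i) (V j)) (hW : ∀ j, W j ∈ 𝓝 (y j))
    (hWV : ∀ j, closure (W j) ⊆ V j) {U₀ : Set E}
    (hU₀ : IsAdmissibleNhd M (fun j => M ∩ closure (W j)) x₀ U₀) :
    ∃ U : Set E, IsOpen U ∧ x₀ ∈ U ∧ U ⊆ U₀ ∧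
      ∃ φ : E → EuclideanSpace ℝ (Fin k) × EuclideanSpace ℝ (Fin d),
        IsBilipschitzOnto φ U (openSimplex k ×ˢ openCube d) ∧
        φ x₀ = (simplexCentre k, cubeCentre d) ∧
        φ '' (conflictSet M (fun j => M ∩ closure (W j)) U₀ ∩ U) =
          simplexAxis k ×ˢ openCube d := by
  have hk0 : k ≠ 0 := by omega
  obtain ⟨q, B, hB⟩ := exists_complementing_map hd hk0 hy x₀
  set N : Fin k → Set E := fun j => M ∩ closure (W j) with hN
  have hNc : ∀ j, closestPoints (N j) x₀ = {y j} := closestPoints_inter_closure hm hV hW hWV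
  let u : E → EuclideanSpace ℝ (Fin k) := fun x => WithLp.toLp 2 fun j => sqDist (N j) x
  let f : E → sumZero k × EuclideanSpace ℝ (Fin d) := fun x => (toSumZero k (u x), q (x - x₀))
  have hu : HasStrictFDerivAt u (innerVec fun j => (2 : ℝ) • (x₀ - y j)) x₀ :=
    hasStrictFDerivAt_euclidean.2 fun j =>
      hasStrictFDerivAt_sqDist (hM.inter isClosed_closure) (hNc j)
  have hf : HasStrictFDerivAt f (B : E →L[ℝ] sumZero k × EuclideanSpace ℝ (Fin d)) x₀ := by
    rw [hB]
    refine ((toSumZero k).hasStrictFDerivAt.comp x₀ hu).prodMk ?_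
    exact (q.hasStrictFDerivAt.comp x₀ ((hasStrictFDerivAt_id x₀).sub_const x₀))
  have hfx₀ : f x₀ = 0 := by
    refine Prod.ext (toSumZero_eq_zero_iff.2 fun i j => ?_) (by simp [f])
    have hdist : ∀ j, sqDist (N j) x₀ = Metric.infDist x₀ M ^ 2 := fun j => by
      have h1 : y j ∈ closestPoints (N j) x₀ := hNc j ▸ mem_singleton _
      have h2 : y j ∈ closestPoints M x₀ := hm ▸ mem_range_self j
      rw [sqDist, ← h1.2, h2.2]
    exact (hdist i).trans (hdist j).symm
  obtain ⟨U, hUo, hxU, hUU₀, r, hr, hbil⟩ := exists_isBilipschitzOnto_smul hf hfx₀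
    (isOpen_preimage_translateToCentre hk0)
    (by rw [mem_preimage, translateToCentre_zero]; exact centre_mem hk0)
    (isometry_translateToCentre.antilipschitz.isBounded_preimage
      (isBounded_openSimplex.prod isBounded_openCube)) hU₀.1
  have hbil' := hbil.isometry_comp isometry_translateToCentre
  rw [image_preimage_eq_of_subset (openSimplex_prod_openCube_subset_range hk0)] at hbil'
  set φ := translateToCentre k d ∘ fun x => r • f x with hφ
  have hsub : ∀ x i j, (φ x).1 i - (φ x).1 j = r * (sqDist (N i) x - sqDist (N j) x) := by
    intro x i j
    have h := toSumZero_sub_apply (u x) i j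
    simp only [hφ, Function.comp, translateToCentre, f, Prod.smul_mk, PiLp.add_apply,
      Submodule.coe_smul, PiLp.smul_apply, smul_eq_mul]
    change _ = r * (u x i - u x j)
    rw [← h]
    simp only [simplexCentre]
    ring
  have hle : ∀ x i j, (φ x).1 i ≤ (φ x).1 j ↔ sqDist (N i) x ≤ sqDist (N j) x := by
    intro x i j
    rw [← sub_nonpos, hsub, ← sub_nonpos (a := sqDist (N i) x)]
    exact ⟨fun h => by by_contra! h'; exact (mul_pos hr h').not_ge h,
      mul_nonpos_of_nonneg_of_nonpos hr.le⟩
  have hiff : ∀ x ∈ U, x ∈ conflictSet M N U₀ ↔ φ x ∈ simplexAxis k ×ˢ openCube d := by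
    intro x hx
    have hφx : φ x ∈ openSimplex k ×ˢ openCube d := hbil'.1 ▸ mem_image_of_mem φ hx
    obtain ⟨⟨m, hmx⟩, hlow⟩ := hU₀.2 x (hUU₀ hx)
    rw [mem_prod, mem_simplexAxis_iff hk, and_assoc, and_iff_right hφx.1, and_iff_left hφx.2]
    simp only [conflictSet, mem_ofPred_eq, hUU₀ hx, true_and, le_antisymm_iff (a := (φ x).1 _), hle,
      ← le_antisymm_iff]
    -- What remains is that `δ_j x` is least among the `δ_l x` iff it equals `δ x`, which is
    -- admissibility of `U₀`; `m` is an index attaining `δ x`.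
    refine exists_congr fun i => exists_congr fun j => and_congr_right fun _ =>
      and_congr_right fun _ => ⟨fun h l => h ▸ hlow (mem_range_self l), fun h => ?_⟩
    exact le_antisymm ((h m).trans_eq hmx) (hlow (mem_range_self j))
  refine ⟨U, hUo, hxU, hUU₀, φ, hbil', ?_, ?_⟩
  · simp only [hφ, Function.comp, hfx₀, smul_zero, translateToCentre_zero]
  · refine Subset.antisymm ?_ fun z hz => ?_
    · rintro _ ⟨x, ⟨hxC, hx⟩, rfl⟩
      exact (hiff x hx).1 hxC
    · obtain ⟨x, hx, rfl⟩ : z ∈ φ '' U := hbil'.1 ▸ ⟨hz.1.2, hz.2⟩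
      exact ⟨x, ⟨(hiff x hx).2 hz, hx⟩, rfl⟩

end

/-- At most four distinct points on a sphere in space are affinely independent, provided that they
do not lie on a circle if there are four of them. -/
theorem affineIndependent_of_cospherical {k : ℕ} (hk2 : 2 ≤ k) (hk4 : k ≤ 4)
    {y : Fin k → EuclideanSpace ℝ (Fin 3)} (hy : Function.Injective y)
    (hs : EuclideanGeometry.Cospherical (range y))
    (hgen : k = 4 → ¬ EuclideanGeometry.Concyclic (range y)) : AffineIndependent ℝ y := by
  obtain rfl | rfl | rfl : k = 2 ∨ k = 3 ∨ k = 4 := by omega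
  · have h : y = ![y 0, y 1] := by
      ext i
      fin_cases i <;> rfl
    rw [h]
    exact affineIndependent_of_ne ℝ (hy.ne (by decide))
  · exact hs.affineIndependent Subset.rfl hy
  · rw [affineIndependent_iff_le_finrank_vectorSpan ℝ y (n := 3) (by simp)]
    -- A span of dimension below three makes the four points coplanar, and cospherical coplanar
    -- points are concyclic.
    by_contra! h
    exact hgen rfl ⟨hs, coplanar_iff_finrank_le_two.2 (Nat.lt_succ_iff.1 h)⟩

end Chart

end MedialAxis

theorem theorem2p4
    (M : Set (EuclideanSpace ℝ (Fin 3))) (hM : IsClosed M)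
    (x₀ : EuclideanSpace ℝ (Fin 3))
    (k : ℕ) (hk2 : 2 ≤ k) (hk4 : k ≤ 4)
    -- the sets `M_j = {y j}`: pairwise disjoint, with union `m(x₀)`
    (y : Fin k → EuclideanSpace ℝ (Fin 3)) (hy : Function.Injective y)
    (hm : MedialAxis.closestPoints M x₀ = range y)
    -- for `k = 4` the points do not lie on a circle
    (hgen : k = 4 → ¬ EuclideanGeometry.Concyclic (range y))
    -- neighbourhoods `W j` of `y j` with closures contained in disjoint sets `V j`
    (V W : Fin k → Set (EuclideanSpace ℝ (Fin 3)))
    (hV : Pairwise fun i j => Disjoint (V i) (V j))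
    (hW : ∀ j, W j ∈ 𝓝 (y j)) (hWV : ∀ j, closure (W j) ⊆ V j) :
    (∃ U₀, MedialAxis.IsAdmissibleNhd M (fun j => M ∩ closure (W j)) x₀ U₀) ∧
    ∀ U₀, MedialAxis.IsAdmissibleNhd M (fun j => M ∩ closure (W j)) x₀ U₀ →
      ∃ U : Set (EuclideanSpace ℝ (Fin 3)), IsOpen U ∧ x₀ ∈ U ∧ U ⊆ U₀ ∧
      ∃ φ : EuclideanSpace ℝ (Fin 3) → EuclideanSpace ℝ (Fin k) × EuclideanSpace ℝ (Fin (4 - k)),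
        MedialAxis.IsBilipschitzOnto φ U
          (MedialAxis.openSimplex k ×ˢ MedialAxis.openCube (4 - k)) ∧
        φ x₀ = (MedialAxis.simplexCentre k, MedialAxis.cubeCentre (4 - k)) ∧
        φ '' (MedialAxis.conflictSet M (fun j => M ∩ closure (W j)) U₀ ∩ U) =
          MedialAxis.simplexAxis k ×ˢ MedialAxis.openCube (4 - k) := by
  have hym : ∀ j, y j ∈ MedialAxis.closestPoints M x₀ := fun j => hm.symm ▸ mem_range_self j
  have hne : M.Nonempty := ⟨_, (hym ⟨0, by omega⟩).1⟩
  have hs : EuclideanGeometry.Cospherical (range y) := ⟨x₀, Metric.infDist x₀ M, by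
    rintro _ ⟨j, rfl⟩
    rw [dist_comm]
    exact (hym j).2⟩
  have hind := MedialAxis.affineIndependent_of_cospherical hk2 hk4 hy hs hgen
  refine ⟨MedialAxis.exists_isAdmissibleNhd hM hne hm hW, fun U₀ hU₀ => ?_⟩
  refine MedialAxis.exists_chart_conflictSet hk2 ?_ hM hm hind hV hW hWV hU₀
  rw [finrank_euclideanSpace_fin]
  omega
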